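/- **Conventions.** Let $d,n,r\ge 0$ be integers. A matrix $X\in\mathcal M_d(\mathbb C)^{\otimes n}$ has entries $\langle i|X|j\rangle$, $i,j\in[d]^n$, in the computational basis. Let $\Pi^{(n)}_d=\frac1{n!}\sum_{\pi\in S_n}P_\pi$ be the orthogonal projection onto the symmetric subspace of $(\mathbb C^d)^{\otimes n}$, where $P_\pi$ permutes the tensor factors. $X$ is *bosonic* if $\Pi^{(n)}_dX\Pi^{(n)}_d=X$; $\operatorname{Herm}[\vee^n\mathbb C^d]$ is the set of Hermitian bosonic matrices. $\mathsf{DS}^{(n)}_d$ is the set of bosonic $X$ with $[U^{\otimes n},X]=0$ for all diagonal unitary $U\in\mathcal M_d(\mathbb C)$, and $Q[X]_i:=\langle i|X|i\rangle$, $i\in[d]^n$. $\operatorname{Tr}_A$ and $\Gamma_A$ denote partial trace and partial transpose on the tensor factors in $A$. A matrix $\tilde X\in\operatorname{Herm}[\vee^{n+r}\mathbb C^d]$ is an *$(n,r)$-hypergraph bosonic extension* of $X\in\operatorname{Herm}[\vee^n\mathbb C^d]$ if $\tilde X\succeq0$ and $\operatorname{Tr}_A(\tilde X)=X$ for every $A\subseteq[n+r]$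 with $|A|=r$; it is a *PPT* one if moreover $\tilde X^{\Gamma_I}\succeq0$ for every $I\subseteq[n+r]$. Let $$\mathsf{BExt}^{(n,r)}_d=\{X\in\operatorname{Herm}[\vee^n\mathbb C^d]:\exists\,\tilde X\in\operatorname{Herm}[\vee^{n+r}\mathbb C^d],\ \tilde X\succeq0,\ \operatorname{Tr}_{[r]}\tilde X=X\},$$ and let $\mathsf{PPTBExt}^{(n,r)}_d$ be defined in the same way with $\tilde X\succeq 0$ replaced by $\tilde X^{\Gamma_{[k]}}\succeq0$ for all $0\le k\le\lfloor (n+r)/2\rfloor$. For real symmetric tensors of order $m$ on $\mathbb R^d$: $\mathsf{NN}^{(m)}_d$ is the set of entrywise nonnegative ones; $\mathsf{Mom}^{(m)}_d$ (*moment tensors*) is the set of those $T$ such that for every $k\geq 0$ with $2k\le m$, every slice of $T$ of order $2k$ (obtained by fixing $m-2k$ of the indices), arranged as a $d^k\times d^k$ matrix, is positive semidefinite. With $\operatorname{tr}_{[r]}(T)_j=\sum_{i\in[d]^r}T_{i\sqcup j}$, put $\mathsf{NNExt}^{(n,r)}_d=\operatorname{tr}_{[r]}(\mathsf{NN}^{(n+r)}_d)$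 and $\mathsf{MomExt}^{(n,r)}_d=\operatorname{tr}_{[r]}(\mathsf{Mom}^{(n+r)}_d)$. **Theorem.** Let $X\in\mathsf{DS}^{(n)}_d$. Then for every $r\ge0$: 1. $X\in\mathsf{BExt}^{(n,r)}_d\iff Q[X]\in\mathsf{NNExt}^{(n,r)}_d$; likewise, $X$ has an $(n,r)$-hypergraph bosonic extension if and only if $Q[X]\in\mathsf{NNExt}^{(n,r)}_d$. 2. $X\in\mathsf{PPTBExt}^{(n,r)}_d\iff Q[X]\in\mathsf{MomExt}^{(n,r)}_d$; likewise, $X$ has an $(n,r)$-hypergraph PPT bosonic extension if and only if $Q[X]\in\mathsf{MomExt}^{(n,r)}_d$. (Here $Q[X]$ is a priori a complex tensor; membership includes that it is real.) -/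

import Mathlib

noncomputable section

namespace Dicke

open scoped ComplexOrder

/-- Matrices in `M_d(ℂ)^{⊗n}`, with rows and columns indexed by the multi-indices `i ∈ [d]^n`
of the computational basis: the entry `X i j` is `⟨i|X|j⟩`. -/
abbrev Op (d n : ℕ) := Matrix (Fin n → Fin d) (Fin n → Fin d) ℂ

/-- Real tensors in `(ℝ^d)^{⊗n}`, given by their components. -/
abbrev RTensor (d n : ℕ) := (Fin n → Fin d) → ℝ

/-- Complex tensors in `(ℂ^d)^{⊗n}`, given by their components. -/
abbrev CTensor (d n : ℕ) := (Fin n → Fin d) → ℂ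

/-- A real tensor viewed as a complex tensor. -/
def RTensor.toComplex {d n : ℕ} (T : RTensor d n) : CTensor d n := fun i => (T i : ℂ)

/-! ### Subsets of tensor factors -/

/-- The subset `[k]` of `[m]`: the first `k` tensor factors. -/
def firstFactors (m k : ℕ) : Finset (Fin m) := Finset.univ.filter fun x => (x : ℕ) < k

theorem card_firstFactors (n r : ℕ) : (firstFactors (n + r) r).card = r := by
  have h := Fin.card_filter_val_lt (n := n + r) (m := r)
  rw [firstFactors, h]
  omega

theorem card_compl_of_card {n r : ℕ} {A : Finset (Fin (n + r))} (hA : A.card = r) :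
    Aᶜ.card = n := by
  rw [Finset.card_compl, Fintype.card_fin, hA]
  omega

/-- The multi-index in `[d]^m` which is given by `a` on the factors in `A`, and whose entries
on the `n` remaining factors are those of `i`, in increasing order. -/
def glue {d m n : ℕ} (A : Finset (Fin m)) (hA : Aᶜ.card = n) (i : Fin n → Fin d)
    (a : A → Fin d) : Fin m → Fin d := fun x =>
  if hx : x ∈ A then a ⟨x, hx⟩
  else i ((Aᶜ.orderIsoOfFin hA).symm ⟨x, Finset.mem_compl.mpr hx⟩)

/-! ### Bosonic and diagonally symmetric matrices -/

/-- The permutation operator `P_π = ∑_i |i_{π⁻¹(1)} … i_{π⁻¹(n)}⟩⟨i_1 … i_n|`. -/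
def permOp (d : ℕ) {n : ℕ} (π : Equiv.Perm (Fin n)) : Op d n :=
  Matrix.of fun j i => if j = (fun k => i (π⁻¹ k)) then 1 else 0

/-- The orthogonal projection `(1/n!) ∑_π P_π` onto the symmetric subspace. -/
def symProj (d n : ℕ) : Op d n :=
  ((n.factorial : ℂ)⁻¹) • ∑ π : Equiv.Perm (Fin n), permOp d π

/-- Bosonic matrices. -/
def IsBosonic {d n : ℕ} (X : Op d n) : Prop := symProj d n * X * symProj d n = X

/-- Hermitian bosonic matrices. -/
def HermBosonic (d n : ℕ) : Set (Op d n) := {X | X.IsHermitian ∧ IsBosonic X}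

/-- The tensor power `U^{⊗n}` of a `d × d` matrix. -/
def tensorPow {d : ℕ} (U : Matrix (Fin d) (Fin d) ℂ) (n : ℕ) : Op d n :=
  Matrix.of fun i j => ∏ k, U (i k) (j k)

/-- The group of diagonal unitary matrices `diag(e^{iθ_1}, …, e^{iθ_d})`. -/
def DU (d : ℕ) : Set (Matrix (Fin d) (Fin d) ℂ) :=
  {U | ∃ θ : Fin d → ℝ, U = Matrix.diagonal fun k => Complex.exp ((θ k : ℂ) * Complex.I)}

/-- The diagonally symmetric subspace: bosonic matrices that commute with `U^{⊗n}` for all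
diagonal unitaries `U`. -/
def DS (d n : ℕ) : Set (Op d n) :=
  {X | IsBosonic X ∧ ∀ U ∈ DU d, tensorPow U n * X = X * tensorPow U n}

/-- The tensor `Q[X]_i = ⟨i|X|i⟩`. -/
def Q {d n : ℕ} (X : Op d n) : CTensor d n := fun i => X i i

/-! ### Partial trace, partial transpose, extensions -/

/-- The partial trace `Tr_A(X)` over the tensor factors in `A`. The `n` remaining factors are
relabelled increasingly. -/
def partialTrace {d m n : ℕ} (A : Finset (Fin m)) (hA : Aᶜ.card = n) (X : Op d m) : Op d n :=
  Matrix.of fun i j => ∑ a : A → Fin d, X (glue A hA i a) (glue A hA j a)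

/-- The partial transpose `X^{Γ_I}` on the tensor factors in `I`: row and column indices are
exchanged at the positions in `I`. -/
def partialTranspose {d n : ℕ} (I : Finset (Fin n)) (X : Op d n) : Op d n :=
  Matrix.of fun i j => X (I.piecewise j i) (I.piecewise i j)

/-- Bosonic positive semidefinite matrices. -/
def PSD (d n : ℕ) : Set (Op d n) := {X | X ∈ HermBosonic d n ∧ X.PosSemidef}

/-- Bosonic matrices with positive partial transpose on the first `k` factors, for every
`0 ≤ k ≤ ⌊n/2⌋`; the case `k = 0` is positivity of the matrix itself. -/
def PPT (d n : ℕ) : Set (Op d n) :=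
  {X | X ∈ HermBosonic d n ∧
    ∀ k : ℕ, k ≤ n / 2 → (partialTranspose (firstFactors n k) X).PosSemidef}

/-- `Y` is an `(n,r)`-hypergraph bosonic extension of `X`. -/
def IsHypergraphBosonicExtension {d n : ℕ} (r : ℕ) (Y : Op d (n + r)) (X : Op d n) : Prop :=
  X ∈ HermBosonic d n ∧ Y ∈ HermBosonic d (n + r) ∧ Y.PosSemidef ∧
    ∀ (A : Finset (Fin (n + r))) (hA : A.card = r), partialTrace A (card_compl_of_card hA) Y = X

/-- `Y` is an `(n,r)`-hypergraph PPT bosonic extension of `X`: it is moreover PPT across all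
bipartitions. -/
def IsHypergraphPPTBosonicExtension {d n : ℕ} (r : ℕ) (Y : Op d (n + r)) (X : Op d n) : Prop :=
  IsHypergraphBosonicExtension r Y X ∧
    ∀ I : Finset (Fin (n + r)), (partialTranspose I Y).PosSemidef

/-- The partial trace `Tr_{[r]}` over the first `r` factors. -/
def trFirst {d n : ℕ} (r : ℕ) (Y : Op d (n + r)) : Op d n :=
  partialTrace (firstFactors (n + r) r) (card_compl_of_card (card_firstFactors n r)) Y

/-- The cone of `(n,r)`-hypergraph bosonic extendible matrices. -/
def BExt (d n r : ℕ) : Set (Op d n) :=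
  {X | X ∈ HermBosonic d n ∧ ∃ Y ∈ PSD d (n + r), trFirst r Y = X}

/-- The cone of `(n,r)`-hypergraph PPT bosonic extendible matrices. -/
def PPTBExt (d n r : ℕ) : Set (Op d n) :=
  {X | X ∈ HermBosonic d n ∧ ∃ Y ∈ PPT d (n + r), trFirst r Y = X}

/-! ### Symmetric tensors -/

/-- Real symmetric tensors, `∨^n ℝ^d`. -/
def SymTensor (d n : ℕ) : Set (RTensor d n) :=
  {T | ∀ (σ : Equiv.Perm (Fin n)) (i : Fin n → Fin d), T i = T (fun k => i (σ k))}

/-- Entrywise nonnegative symmetric tensors. -/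
def NN (d n : ℕ) : Set (RTensor d n) := {T | T ∈ SymTensor d n ∧ ∀ i, 0 ≤ T i}

/-- The slice of `T` obtained by fixing the indices at the positions in `I` to the values `a`;
a tensor of order `m = n - |I|`. -/
def slice {d n m : ℕ} (T : RTensor d n) (I : Finset (Fin n)) (hI : Iᶜ.card = m)
    (a : I → Fin d) : RTensor d m := fun j => T (glue I hI j a)

/-- The balanced flattening of a tensor of even order `2k` to a `d^k × d^k` matrix. -/
def flattening {d k : ℕ} (T : RTensor d (k + k)) :
    Matrix (Fin k → Fin d) (Fin k → Fin d) ℝ :=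
  Matrix.of fun u v => T (Fin.append u v)

/-- Moment tensors: symmetric tensors for which the balanced flattening of every slice of even
order is positive semidefinite. -/
def Mom (d n : ℕ) : Set (RTensor d n) :=
  {T | T ∈ SymTensor d n ∧
    ∀ (k : ℕ) (I : Finset (Fin n)) (hI : Iᶜ.card = k + k) (a : I → Fin d),
      (flattening (slice T I hI a)).PosSemidef}

/-- The partial trace (marginal) `tr_A(T)` of a tensor. -/
def tensorTrace {d m n : ℕ} (A : Finset (Fin m)) (hA : Aᶜ.card = n) (T : RTensor d m) :
    RTensor d n := fun j => ∑ a : A → Fin d, T (glue A hA j a)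

/-- The partial trace `tr_{[r]}` of a tensor over the first `r` indices. -/
def tensorTrFirst {d n : ℕ} (r : ℕ) (T : RTensor d (n + r)) : RTensor d n :=
  tensorTrace (firstFactors (n + r) r) (card_compl_of_card (card_firstFactors n r)) T

/-- Partial traces of entrywise nonnegative symmetric tensors of order `n + r`. -/
def NNExt (d n r : ℕ) : Set (RTensor d n) := {T | ∃ S ∈ NN d (n + r), tensorTrFirst r S = T}

/-- Partial traces of moment tensors of order `n + r`. -/
def MomExt (d n r : ℕ) : Set (RTensor d n) := {T | ∃ S ∈ Mom d (n + r), tensorTrFirst r S = T}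

end Dicke

end

open scoped ComplexOrder

namespace Dicke

/-! Entries of a bosonic matrix depend only on the contents (multisets of values) of the row and
column indices, and diagonal symmetry kills those with unequal contents. So `X` is recovered from
its diagonal (`eq_dickeMatrix`), and partial traces act on `dickeMatrix T` as on `T`.

From matrices to tensors, only the diagonal of an extension `Y` matters, so `Y` need not be
diagonally symmetric. Nonnegativity is immediate; in the PPT case each flattened even slice of the
diagonal is a submatrix of some `Y^{Γ_[k]}` (`realDiag_mem_Mom`).

Conversely, a tensor `S` is lifted to `dickeMatrix S`. Its blocks are constant, hence positive for
`S ≥ 0`. For moment tensors, every partial transpose is again block diagonal, with blocks drawn from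
flattened slices (`partialTranspose_dickeMatrix_posSemidef`). Symmetry of `S` makes all traces over
`r` factors equal, which gives the hypergraph versions. -/

/-! ### The content of a multi-index -/

/-- The multiset of values of a multi-index. -/
def content {ι α : Type*} [Fintype ι] (i : ι → α) : Multiset α := ∑ k, {i k}

section content

variable {ι κ α : Type*} [Fintype ι] [Fintype κ]

theorem content_eq_map (i : ι → α) : content i = Finset.univ.val.map i := by
  have h := Multiset.sum_map_singleton ((Finset.univ : Finset ι).val.map i)
  rw [Multiset.map_map] at h
  exact h

theorem content_comp_equiv (e : κ ≃ ι) (i : ι → α) : content (i ∘ e) = content i :=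
  Equiv.sum_comp e fun k => ({i k} : Multiset α)

theorem card_content (i : ι → α) : Multiset.card (content i) = Fintype.card ι := by
  simp [content_eq_map]

/-- Equal multiplicities make the fibres over each value equinumerous; bijections between fibres
assemble to a permutation. -/
theorem exists_perm_of_content_eq {i j : ι → α} (h : content i = content j) :
    ∃ σ : Equiv.Perm ι, i = j ∘ σ := by
  classical
  have hc (c : α) : Nonempty ({x // i x = c} ≃ {x // j x = c}) := by
    have := congrArg (Multiset.count c) h
    simp only [content_eq_map, Multiset.count_map] at this
    refine ⟨Fintype.equivOfCardEq ?_⟩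
    rw [Fintype.card_subtype, Fintype.card_subtype]
    simpa [Finset.card, Finset.filter_val, eq_comm] using this
  exact ⟨Equiv.ofFiberEquiv fun c => (hc c).some,
    funext fun x => (Equiv.ofFiberEquiv_map _ x).symm⟩

theorem exists_content_eq (m : Multiset α) (h : Multiset.card m = Fintype.card ι) :
    ∃ i : ι → α, content i = m := by
  induction m using Quotient.inductionOn with
  | _ l =>
    have e : ι ≃ Fin l.length := Fintype.equivOfCardEq (by simpa using h.symm)
    refine ⟨l.get ∘ e, ?_⟩
    rw [content_comp_equiv, content_eq_map, Fin.univ_val_map, List.ofFn_get]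
    rfl

theorem content_append {k l : ℕ} (u : Fin k → α) (v : Fin l → α) :
    content (Fin.append u v) = content u + content v := by
  simp [content, Fin.sum_univ_add]

theorem content_piecewise [DecidableEq ι] (I : Finset ι) (i j : ι → α) :
    content (I.piecewise j i) = ∑ x ∈ I, {j x} + ∑ x ∈ Iᶜ, {i x} := by
  rw [content, ← Finset.sum_add_sum_compl I]
  congr 1
  · exact Finset.sum_congr rfl fun x hx => by rw [Finset.piecewise_eq_of_mem _ _ _ hx]
  · exact Finset.sum_congr rfl fun x hx => by
      rw [Finset.piecewise_eq_of_notMem _ _ _ (Finset.mem_compl.mp hx)]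

theorem content_glue {d m n : ℕ} (A : Finset (Fin m)) (hA : Aᶜ.card = n) (i : Fin n → Fin d)
    (a : A → Fin d) : content (glue A hA i a) = content i + content a := by
  rw [content, ← Finset.sum_compl_add_sum A]
  congr 1
  · rw [← Finset.sum_coe_sort, content,
      ← Equiv.sum_comp (Aᶜ.orderIsoOfFin hA).symm.toEquiv fun k => ({i k} : Multiset (Fin d))]
    refine Finset.sum_congr rfl fun x _ => ?_
    simp [glue, Finset.mem_compl.mp x.2]
  · rw [← Finset.sum_coe_sort, content]
    refine Finset.sum_congr rfl fun x _ => ?_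
    simp [glue]

theorem piecewise_glue {d m n : ℕ} (A : Finset (Fin m)) (hA : Aᶜ.card = n)
    (i j : Fin n → Fin d) (a b : A → Fin d) :
    A.piecewise (glue A hA i a) (glue A hA j b) = glue A hA j a := by
  funext x
  by_cases hx : x ∈ A <;> simp [glue, hx]

end content

/-! ### Positive semidefinite matrices -/

section PosSemidef

open Matrix
open scoped MatrixOrder

variable {ι κ : Type*} [Fintype ι]

theorem posSemidef_map_ofReal {M : Matrix ι ι ℝ} :
    (M.map ((↑) : ℝ → ℂ)).PosSemidef ↔ M.PosSemidef := by
  classical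
  constructor
  · intro h
    refine PosSemidef.of_dotProduct_mulVec_nonneg ?_ fun x => ?_
    · ext i j
      have := congrFun (congrFun h.1 i) j
      simpa using this
    · have := h.dotProduct_mulVec_nonneg fun i => (x i : ℂ)
      rw [← Complex.zero_le_real]
      refine this.trans_eq ?_
      simp [dotProduct, mulVec]
  · intro h
    obtain ⟨B, rfl⟩ := CStarAlgebra.nonneg_iff_eq_star_mul_self.mp h.nonneg
    have : (star B * B).map ((↑) : ℝ → ℂ) = (B.map ((↑) : ℝ → ℂ))ᴴ * B.map ((↑) : ℝ → ℂ) := by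
      ext i j
      simp [mul_apply, star_eq_conjTranspose]
    rw [this]
    exact posSemidef_conjTranspose_mul_self _

/-- A block-diagonal matrix with positive semidefinite diagonal blocks is positive
semidefinite. -/
theorem posSemidef_of_fibers (f : ι → κ) (N : Matrix ι ι ℂ)
    (h0 : ∀ i j, f i ≠ f j → N i j = 0)
    (h : ∀ c, (N.submatrix (Subtype.val : {i : ι // f i = c} → ι) Subtype.val).PosSemidef) :
    N.PosSemidef := by
  classical
  have hs (c : κ) (g : ι → ℂ) (l : ι) :
      ∑ k : {i : ι // f i = c}, (if k.1 = l then g k.1 else 0) = if f l = c then g l else 0 := by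
    split_ifs with hl
    · rw [Finset.sum_eq_single ⟨l, hl⟩] <;> simp +contextual [Subtype.ext_iff]
    · exact Finset.sum_eq_zero fun k _ => if_neg fun hk : k.1 = l => hl (hk ▸ k.2)
  have hP (c : κ) : ∃ P : Matrix ι ι ℂ, P.PosSemidef ∧
      ∀ i j, P i j = if f i = c then (if f j = c then N i j else 0) else 0 := by
    -- `E` restricts coordinates to the fibre over `c`, so `Eᴴ * N_c * E` is the block `N_c` padded
    -- with zeros.
    let E : Matrix {i : ι // f i = c} ι ℂ := of fun k l => if k.1 = l then 1 else 0
    refine ⟨_, (h c).conjTranspose_mul_mul_same E, fun i j => ?_⟩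
    have hN (k : ι) :
        ∑ l : {i : ι // f i = c}, (if l.1 = i then N l.1 k else 0) = if f i = c then N i k else 0 :=
      hs c (fun l => N l k) i
    simp only [E, mul_apply, conjTranspose_apply, of_apply, submatrix_apply, apply_ite star,
      star_one, star_zero, ite_mul, one_mul, zero_mul, mul_ite, mul_one, mul_zero, hN]
    rw [hs c (fun k => if f i = c then N i k else 0)]
    split_ifs <;> rfl
  choose P hP hPN using hP
  have key : N = ∑ c ∈ Finset.univ.image f, P c := by
    ext i j
    rw [Matrix.sum_apply]
    simp only [hPN]
    rw [Finset.sum_ite_eq]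
    by_cases hij : f j = f i
    · simp [hij]
    · simp [hij, h0 i j (Ne.symm hij)]
  rw [key]
  exact posSemidef_sum _ fun c _ => hP c

end PosSemidef

/-! ### Bosonic matrices -/

section bosonic

variable {d n : ℕ}

theorem permOp_mul_apply (π : Equiv.Perm (Fin n)) (X : Op d n) (i j : Fin n → Fin d) :
    (permOp d π * X) i j = X (i ∘ π) j := by
  rw [Matrix.mul_apply, Finset.sum_eq_single (i ∘ π)]
  · have : i = fun k => (i ∘ π) (π⁻¹ k) := by funext k; simp
    simp [permOp]
  · intro l _ hl
    have : i ≠ fun k => l (π⁻¹ k) := by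
      rintro rfl
      exact hl (by funext k; simp)
    rw [permOp, Matrix.of_apply, if_neg this]; simp
  · simp

theorem mul_permOp_apply (π : Equiv.Perm (Fin n)) (X : Op d n) (i j : Fin n → Fin d) :
    (X * permOp d π) i j = X i (j ∘ ⇑π⁻¹) := by
  rw [Matrix.mul_apply, Finset.sum_eq_single (j ∘ ⇑π⁻¹)]
  · simp [permOp, Function.comp_def]
  · intro l _ hl
    have : l ≠ fun k => j (π⁻¹ k) := hl
    rw [permOp, Matrix.of_apply, if_neg this]; simp
  · simp

theorem permOp_mul_permOp (π ρ : Equiv.Perm (Fin n)) :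
    permOp d π * permOp d ρ = permOp d (π * ρ) := by
  ext i j
  rw [mul_permOp_apply]
  simp [permOp, Function.comp_def]

theorem permOp_mul_symProj (π : Equiv.Perm (Fin n)) : permOp d π * symProj d n = symProj d n := by
  simp only [symProj, Matrix.mul_smul, Finset.mul_sum, permOp_mul_permOp]
  congr 1
  exact Equiv.sum_comp (Equiv.mulLeft π) fun ρ => permOp d ρ

theorem symProj_mul_permOp (π : Equiv.Perm (Fin n)) : symProj d n * permOp d π = symProj d n := by
  simp only [symProj, Matrix.smul_mul, Finset.sum_mul, permOp_mul_permOp]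
  congr 1
  exact Equiv.sum_comp (Equiv.mulRight π) fun ρ => permOp d ρ

/-- The symmetric projection absorbs every `P_π` on either side, so row and column indices can be
permuted independently. -/
theorem IsBosonic.apply_congr {X : Op d n} (hX : IsBosonic X) {i i' j j' : Fin n → Fin d}
    (hi : content i = content i') (hj : content j = content j') : X i j = X i' j' := by
  obtain ⟨σ, rfl⟩ := exists_perm_of_content_eq hi
  obtain ⟨τ, rfl⟩ := exists_perm_of_content_eq hj
  have h1 : permOp d σ * X = X := by
    rw [← hX, ← mul_assoc, ← mul_assoc, permOp_mul_symProj]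
  have h2 : X * permOp d (τ⁻¹) = X := by
    rw [← hX, mul_assoc, symProj_mul_permOp]
  rw [← permOp_mul_apply σ X, h1]
  have := mul_permOp_apply (τ⁻¹) X i' j'
  rw [h2, inv_inv] at this
  exact this.symm

theorem isBosonic_of_apply_congr {X : Op d n}
    (hX : ∀ i i' j j', content i = content i' → content j = content j' → X i j = X i' j') :
    IsBosonic X := by
  have h1 (π : Equiv.Perm (Fin n)) : permOp d π * X = X := by
    ext i j
    rw [permOp_mul_apply]
    exact hX _ _ _ _ (content_comp_equiv π i) rfl
  have h2 (π : Equiv.Perm (Fin n)) : X * permOp d π = X := by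
    ext i j
    rw [mul_permOp_apply]
    exact hX _ _ _ _ rfl (content_comp_equiv (π⁻¹) j)
  have hn : (n.factorial : ℂ) ≠ 0 := Nat.cast_ne_zero.mpr n.factorial_ne_zero
  have h3 : symProj d n * X = X := by
    simp only [symProj, Matrix.smul_mul, Finset.sum_mul, h1, Finset.sum_const, Finset.card_univ,
      Fintype.card_perm, Fintype.card_fin]
    rw [← Nat.cast_smul_eq_nsmul ℂ, smul_smul, inv_mul_cancel₀ hn, one_smul]
  have h4 : X * symProj d n = X := by
    simp only [symProj, Matrix.mul_smul, Finset.mul_sum, h2, Finset.sum_const, Finset.card_univ,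
      Fintype.card_perm, Fintype.card_fin]
    rw [← Nat.cast_smul_eq_nsmul ℂ, smul_smul, inv_mul_cancel₀ hn, one_smul]
  rw [IsBosonic, h3, h4]

theorem SymTensor.apply_congr {T : RTensor d n} (hT : T ∈ SymTensor d n) {i j : Fin n → Fin d}
    (h : content i = content j) : T i = T j := by
  obtain ⟨σ, rfl⟩ := exists_perm_of_content_eq h
  exact (hT σ j).symm

theorem tensorPow_diagonal (u : Fin d → ℂ) :
    tensorPow (Matrix.diagonal u) n = Matrix.diagonal fun i => ∏ k, u (i k) := by
  ext i j
  by_cases h : i = j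
  · subst h
    simp [tensorPow]
  · obtain ⟨k, hk⟩ := Function.ne_iff.mp h
    rw [Matrix.diagonal_apply_ne _ h]
    exact Finset.prod_eq_zero (Finset.mem_univ k) (Matrix.diagonal_apply_ne _ hk)

/-- Diagonally symmetric matrices are block diagonal with respect to the content. -/
theorem DS.apply_eq_zero {X : Op d n} (hX : X ∈ DS d n) {i j : Fin n → Fin d}
    (h : content i ≠ content j) : X i j = 0 := by
  obtain ⟨c, hc⟩ : ∃ c, (content i).count c ≠ (content j).count c := by
    by_contra! hcon
    exact h (Multiset.ext.mpr hcon)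
  by_contra hne
  -- Multiplicities are at most `n`, so their multiples of `t` lie in `[0, π]`, where cosine is
  -- injective. The `+ 1` covers `n = 0`.
  set t : ℝ := Real.pi / (n + 1)
  have hU := hX.2 _ ⟨fun k => if k = c then t else 0, rfl⟩
  rw [tensorPow_diagonal] at hU
  have hij := congrFun (congrFun hU i) j
  rw [Matrix.diagonal_mul, Matrix.mul_diagonal, mul_comm (X i j)] at hij
  have hprod (l : Fin n → Fin d) :
      ∏ k, Complex.exp (((if l k = c then t else 0 : ℝ) : ℂ) * Complex.I) =
        Complex.exp (((content l).count c * t : ℝ) * Complex.I) := by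
    rw [← Complex.exp_sum, ← Finset.sum_mul, ← Complex.ofReal_sum, content, Multiset.count_sum']
    congr 3
    push_cast
    rw [Finset.sum_mul]
    refine Finset.sum_congr rfl fun k _ => ?_
    simp [Multiset.count_singleton, eq_comm]
  rw [hprod, hprod] at hij
  have hre := congrArg Complex.re (mul_right_cancel₀ hne hij)
  rw [Complex.exp_ofReal_mul_I_re, Complex.exp_ofReal_mul_I_re] at hre
  have ht : 0 < t := by positivity
  have hmem (l : Fin n → Fin d) : ((content l).count c * t : ℝ) ∈ Set.Icc 0 Real.pi := by
    refine ⟨by positivity, ?_⟩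
    have hle : (content l).count c ≤ n := by
      simpa [card_content] using Multiset.count_le_card c (content l)
    have hle' : ((content l).count c : ℝ) ≤ n + 1 := by
      exact_mod_cast hle.trans (Nat.le_succ n)
    calc ((content l).count c * t : ℝ) ≤ (n + 1) * t := by gcongr
      _ = Real.pi := by simp only [t]; field_simp
  have := Real.injOn_cos (hmem i) (hmem j) hre
  exact hc (by exact_mod_cast mul_right_cancel₀ ht.ne' this)

end bosonic

/-! ### The diagonally symmetric matrix of a symmetric tensor -/

section dickeMatrix

variable {d n : ℕ}

/-- The diagonally symmetric matrix with the tensor `T` as its diagonal. -/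
def dickeMatrix (T : RTensor d n) : Op d n :=
  Matrix.of fun i j => if content i = content j then (T i : ℂ) else 0

theorem dickeMatrix_apply (T : RTensor d n) (i j : Fin n → Fin d) :
    dickeMatrix T i j = if content i = content j then (T i : ℂ) else 0 := rfl

theorem eq_dickeMatrix {X : Op d n} (hX : X ∈ DS d n) {T : RTensor d n}
    (hT : T.toComplex = Q X) : X = dickeMatrix T := by
  ext i j
  rw [dickeMatrix_apply]
  split_ifs with h
  · rw [hX.1.apply_congr rfl h.symm]
    exact (congrFun hT i).symm
  · exact DS.apply_eq_zero hX h

theorem dickeMatrix_mem_hermBosonic {T : RTensor d n} (hT : T ∈ SymTensor d n) :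
    dickeMatrix T ∈ HermBosonic d n := by
  constructor
  · ext i j
    simp only [Matrix.conjTranspose_apply, dickeMatrix_apply, apply_ite star, star_zero,
      eq_comm (a := content j)]
    split_ifs with h
    · simp [SymTensor.apply_congr hT h]
    · rfl
  · refine isBosonic_of_apply_congr fun i i' j j' hi hj => ?_
    simp only [dickeMatrix_apply, hi, hj, SymTensor.apply_congr hT hi]

theorem dickeMatrix_posSemidef {T : RTensor d n} (hT : T ∈ NN d n) :
    (dickeMatrix T).PosSemidef := by
  refine posSemidef_of_fibers content _ (fun i j h => if_neg h) fun c => ?_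
  -- On a fixed content `T` is constant, so the block is rank one, generated by the vector of square
  -- roots.
  convert Matrix.posSemidef_vecMulVec_self_star
    fun i : {i : Fin n → Fin d // content i = c} => ((Real.sqrt (T i) : ℝ) : ℂ) using 1
  ext ⟨i, hi⟩ ⟨j, hj⟩
  have hij : content i = content j := hi.trans hj.symm
  simp only [Matrix.submatrix_apply, dickeMatrix_apply, if_pos hij, Matrix.vecMulVec_apply,
    Pi.star_apply, RCLike.star_def, Complex.conj_ofReal, ← SymTensor.apply_congr hT.1 hij]
  rw [← Complex.ofReal_mul, Real.mul_self_sqrt (hT.2 i)]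

/-- Fixing all indices leaves a slice of order `0`, whose flattening is the `1 × 1` matrix of an
entry. -/
theorem Mom.subset_NN : Mom d n ⊆ NN d n := fun T hT => by
  refine ⟨hT.1, fun i => ?_⟩
  have h := hT.2 0 Finset.univ (by simp) fun x => i x
  have := h.diag_nonneg (i := Fin.elim0)
  refine this.trans_eq (congrArg T ?_)
  funext x
  simp [glue]

/-- Partial transposes of the matrix of a moment tensor are block diagonal, and their blocks are
submatrices of flattened slices of the tensor. -/
theorem partialTranspose_dickeMatrix_posSemidef {T : RTensor d n} (hT : T ∈ Mom d n)
    (I : Finset (Fin n)) : (partialTranspose I (dickeMatrix T)).PosSemidef := by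
  set α : (Fin n → Fin d) → Multiset (Fin d) := fun i => ∑ x ∈ I, {i x} with hα
  set β : (Fin n → Fin d) → Multiset (Fin d) := fun i => ∑ x ∈ Iᶜ, {i x} with hβ
  have hαc (i) : Multiset.card (α i) = I.card := by simp [hα]
  have hβc (i) : Multiset.card (β i) = Iᶜ.card := by simp [hβ]
  have hent (i j) : partialTranspose I (dickeMatrix T) i j =
      if α j + β i = α i + β j then ((T (I.piecewise j i) : ℝ) : ℂ) else 0 := by
    simp only [partialTranspose, Matrix.of_apply, dickeMatrix_apply, content_piecewise, hα, hβ]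
  -- A nonzero entry forces the signed difference of `α` and `β` to agree at `i` and `j`; the pair
  -- of truncated differences records its positive and negative parts.
  refine posSemidef_of_fibers (fun i => (α i - β i, β i - α i)) _ (fun i j h => ?_) ?_
  · rw [hent, if_neg]
    contrapose! h
    have hc (c) := congrArg (Multiset.count c) h
    simp only [Multiset.count_add] at hc
    simp only [Prod.mk.injEq, Multiset.ext, Multiset.count_sub]
    exact ⟨fun c => by have := hc c; omega, fun c => by have := hc c; omega⟩
  · rintro ⟨p, q⟩
    rcases isEmpty_or_nonempty {i // (α i - β i, β i - α i) = (p, q)} with hE | ⟨⟨i₀, hi₀⟩⟩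
    · convert Matrix.PosSemidef.zero using 1
      exact Subsingleton.elim _ _
    have hsplit (i) : α i = (α i - β i) + (α i ∩ β i) ∧ β i = (β i - α i) + (α i ∩ β i) := by
      simp only [Multiset.ext, Multiset.count_add, Multiset.count_sub, Multiset.count_inter]
      exact ⟨fun c => by omega, fun c => by omega⟩
    set k := Multiset.card (α i₀ ∩ β i₀)
    have hcard {i} (hi : (α i - β i, β i - α i) = (p, q)) :
        Multiset.card p + Multiset.card (α i ∩ β i) = I.card ∧
          Multiset.card q + Multiset.card (α i ∩ β i) = Iᶜ.card := by
      rw [Prod.mk.injEq] at hi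
      have h := hsplit i
      rw [hi.1, hi.2] at h
      exact ⟨by rw [← Multiset.card_add, ← h.1, hαc], by rw [← Multiset.card_add, ← h.2, hβc]⟩
    have hk {i} (hi : (α i - β i, β i - α i) = (p, q)) : Multiset.card (α i ∩ β i) = k := by
      have h1 := hcard hi
      have h2 := hcard hi₀
      omega
    have hIc : I.card + Iᶜ.card = n := by simp
    have hc₀ := hcard hi₀
    -- On this block `α i = p + γ i` and `β i = q + γ i` with `γ i = α i ∩ β i` of size `k`, so the
    -- entry has content `p + q + γ i + γ j`. The slice thus fixes `p + q`; by symmetry any `n - 2k`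
    -- positions serve.
    obtain ⟨J, -, hJ⟩ := Finset.exists_subset_card_eq (s := (Finset.univ : Finset (Fin n)))
      (n := n - (k + k)) (by simp)
    have hJc : Jᶜ.card = k + k := by
      rw [Finset.card_compl, hJ, Fintype.card_fin]
      omega
    obtain ⟨a, ha⟩ := exists_content_eq (ι := J) (p + q) (by
      rw [Multiset.card_add, Fintype.card_coe, hJ]
      omega)
    have hg (i : {i // (α i - β i, β i - α i) = (p, q)}) :
        ∃ g : Fin k → Fin d, content g = α i ∩ β i :=
      exists_content_eq _ (by rw [hk i.2, Fintype.card_fin])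
    choose g hg using hg
    convert (posSemidef_map_ofReal.mpr (hT.2 k J hJc a)).submatrix g using 1
    ext ⟨i, hi⟩ ⟨j, hj⟩
    rw [Prod.mk.injEq] at hi hj
    have h1 := hsplit i
    have h2 := hsplit j
    rw [hi.1, hi.2] at h1
    rw [hj.1, hj.2] at h2
    simp only [Matrix.submatrix_apply, Matrix.map_apply, flattening, slice, Matrix.of_apply, hent]
    rw [if_pos]
    · congr 1
      apply SymTensor.apply_congr hT.1
      rw [content_piecewise, content_glue, content_append, hg, hg, ha]
      refine (congrArg₂ (· + ·) h2.1 h1.2).trans ?_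
      dsimp only
      abel
    · refine (congrArg₂ (· + ·) h2.1 h1.2).trans (Eq.trans ?_ (congrArg₂ (· + ·) h1.1 h2.2).symm)
      abel

end dickeMatrix

/-! ### Partial traces -/

section trace

variable {d n r : ℕ}

theorem partialTrace_dickeMatrix {m : ℕ} (A : Finset (Fin m)) (hA : Aᶜ.card = n)
    (T : RTensor d m) :
    partialTrace A hA (dickeMatrix T) = dickeMatrix (tensorTrace A hA T) := by
  ext i j
  simp only [partialTrace, tensorTrace, Matrix.of_apply, dickeMatrix_apply, content_glue,
    add_left_inj]
  split_ifs <;> simp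

theorem tensorTrace_eq_of_card_eq {m : ℕ} {T : RTensor d m} (hT : T ∈ SymTensor d m)
    {A B : Finset (Fin m)} (hA : Aᶜ.card = n) (hB : Bᶜ.card = n) (h : A.card = B.card) :
    tensorTrace A hA T = tensorTrace B hB T := by
  funext j
  have e : A ≃ B := Fintype.equivOfCardEq (by simpa using h)
  refine Fintype.sum_equiv (e.arrowCongr (Equiv.refl _)) _ _ fun a => ?_
  apply SymTensor.apply_congr hT
  rw [content_glue, content_glue]
  congr 1
  exact (content_comp_equiv e.symm a).symm

theorem tensorTrFirst_mem_symTensor {T : RTensor d (n + r)} (hT : T ∈ SymTensor d (n + r)) :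
    tensorTrFirst r T ∈ SymTensor d n := fun σ i => by
  refine Finset.sum_congr rfl fun a _ => SymTensor.apply_congr hT ?_
  rw [content_glue, content_glue]
  congr 1
  exact (content_comp_equiv σ i).symm

/-- The real diagonal of a matrix. -/
def realDiag (Y : Op d n) : RTensor d n := fun i => (Y i i).re

theorem ofReal_realDiag {Y : Op d n} (hY : Y.IsHermitian) (i : Fin n → Fin d) :
    (realDiag Y i : ℂ) = Y i i :=
  hY.coe_re_apply_self i

theorem realDiag_mem_symTensor {Y : Op d n} (hY : IsBosonic Y) :
    realDiag Y ∈ SymTensor d n := fun σ i =>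
  have h : content i = content (i ∘ σ) := (content_comp_equiv σ i).symm
  congrArg Complex.re (hY.apply_congr h h)

theorem toComplex_tensorTrFirst_realDiag {Y : Op d (n + r)} (hY : Y.IsHermitian) :
    (tensorTrFirst r (realDiag Y)).toComplex = Q (trFirst r Y) := by
  funext i
  simp only [RTensor.toComplex, tensorTrFirst, tensorTrace, Complex.ofReal_sum,
    ofReal_realDiag hY]
  rfl

theorem realDiag_mem_NN {Y : Op d n} (hY : Y ∈ PSD d n) : realDiag Y ∈ NN d n :=
  ⟨realDiag_mem_symTensor hY.1.2, fun _ => (Complex.le_def.mp hY.2.diag_nonneg).1⟩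

/-- Give row `u` the values `u` on the first `k` factors and content `u + a` on the rest.
Transposing the first `k` factors then gives both indices of entry `(u, v)` the content `u + v + a`,
hence a diagonal entry of `Y`. -/
theorem realDiag_mem_Mom {Y : Op d n} (hY : Y ∈ PPT d n) : realDiag Y ∈ Mom d n := by
  refine ⟨realDiag_mem_symTensor hY.1.2, fun k I hI a => ?_⟩
  have hIc : I.card + Iᶜ.card = n := by simp
  have hF : (firstFactors n k).card = k := by
    have h := Fin.card_filter_val_lt (n := n) (m := k)
    rw [firstFactors, h]
    omega
  have hFc : (firstFactors n k)ᶜ.card = n - k := by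
    rw [Finset.card_compl, hF, Fintype.card_fin]
  have e : firstFactors n k ≃ Fin k := Fintype.equivOfCardEq (by simpa using hF)
  have hb (u : Fin k → Fin d) : ∃ b : Fin (n - k) → Fin d, content b = content u + content a :=
    exists_content_eq _ (by
      rw [Multiset.card_add, card_content, card_content, Fintype.card_fin, Fintype.card_fin,
        Fintype.card_coe]
      omega)
  choose b hb using hb
  rw [← posSemidef_map_ofReal]
  convert (hY.2 k (by omega)).submatrix fun u : Fin k → Fin d =>
    glue (firstFactors n k) hFc (b u) (u ∘ e) using 1
  ext u v
  simp only [Matrix.map_apply, flattening, slice, Matrix.of_apply, Matrix.submatrix_apply,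
    partialTranspose, piecewise_glue, ofReal_realDiag hY.1.1]
  apply hY.1.2.apply_congr <;>
  · simp only [content_glue, content_append, hb, content_comp_equiv]
    abel

end trace

/-! ### Extensions of diagonally symmetric matrices -/

section extension

variable {d n r : ℕ} {X : Op d n}

theorem Q_mem_NNExt (hX : X ∈ BExt d n r) : Q X ∈ RTensor.toComplex '' NNExt d n r := by
  obtain ⟨-, Y, hY, rfl⟩ := hX
  exact ⟨_, ⟨_, realDiag_mem_NN hY, rfl⟩, toComplex_tensorTrFirst_realDiag hY.1.1⟩

theorem Q_mem_MomExt (hX : X ∈ PPTBExt d n r) : Q X ∈ RTensor.toComplex '' MomExt d n r := by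
  obtain ⟨-, Y, hY, rfl⟩ := hX
  exact ⟨_, ⟨_, realDiag_mem_Mom hY, rfl⟩, toComplex_tensorTrFirst_realDiag hY.1.1⟩

theorem IsHypergraphBosonicExtension.mem_BExt {Y : Op d (n + r)}
    (h : IsHypergraphBosonicExtension r Y X) : X ∈ BExt d n r :=
  ⟨h.1, Y, ⟨h.2.1, h.2.2.1⟩, h.2.2.2 _ (card_firstFactors n r)⟩

theorem IsHypergraphPPTBosonicExtension.mem_PPTBExt {Y : Op d (n + r)}
    (h : IsHypergraphPPTBosonicExtension r Y X) : X ∈ PPTBExt d n r :=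
  ⟨h.1.1, Y, ⟨h.1.2.1, fun _ _ => h.2 _⟩, h.1.2.2.2 _ (card_firstFactors n r)⟩

theorem isHypergraphBosonicExtension_dickeMatrix (hX : X ∈ DS d n) {S : RTensor d (n + r)}
    (hS : S ∈ NN d (n + r)) (h : (tensorTrFirst r S).toComplex = Q X) :
    IsHypergraphBosonicExtension r (dickeMatrix S) X := by
  have hXS := eq_dickeMatrix hX h
  refine ⟨?_, dickeMatrix_mem_hermBosonic hS.1, dickeMatrix_posSemidef hS, fun A hA => ?_⟩
  · rw [hXS]
    exact dickeMatrix_mem_hermBosonic (tensorTrFirst_mem_symTensor hS.1)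
  · rw [partialTrace_dickeMatrix, hXS]
    congr 1
    exact tensorTrace_eq_of_card_eq hS.1 _ _ (hA.trans (card_firstFactors n r).symm)

theorem exists_isHypergraphBosonicExtension (hX : X ∈ DS d n)
    (h : Q X ∈ RTensor.toComplex '' NNExt d n r) :
    ∃ Y : Op d (n + r), IsHypergraphBosonicExtension r Y X := by
  obtain ⟨_, ⟨S, hS, rfl⟩, h⟩ := h
  exact ⟨_, isHypergraphBosonicExtension_dickeMatrix hX hS h⟩

theorem exists_isHypergraphPPTBosonicExtension (hX : X ∈ DS d n)
    (h : Q X ∈ RTensor.toComplex '' MomExt d n r) :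
    ∃ Y : Op d (n + r), IsHypergraphPPTBosonicExtension r Y X := by
  obtain ⟨_, ⟨S, hS, rfl⟩, h⟩ := h
  exact ⟨_, isHypergraphBosonicExtension_dickeMatrix hX (Mom.subset_NN hS) h,
    partialTranspose_dickeMatrix_posSemidef hS⟩

end extension

end Dicke


theorem mainTheorem9 (d n : ℕ) (X : Dicke.Op d n) (hX : X ∈ Dicke.DS d n) (r : ℕ) :
    ((X ∈ Dicke.BExt d n r ↔ Dicke.Q X ∈ Dicke.RTensor.toComplex '' Dicke.NNExt d n r) ∧
      ((∃ Y : Dicke.Op d (n + r), Dicke.IsHypergraphBosonicExtension r Y X) ↔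
        Dicke.Q X ∈ Dicke.RTensor.toComplex '' Dicke.NNExt d n r)) ∧
    ((X ∈ Dicke.PPTBExt d n r ↔ Dicke.Q X ∈ Dicke.RTensor.toComplex '' Dicke.MomExt d n r) ∧
      ((∃ Y : Dicke.Op d (n + r), Dicke.IsHypergraphPPTBosonicExtension r Y X) ↔
        Dicke.Q X ∈ Dicke.RTensor.toComplex '' Dicke.MomExt d n r)) :=
  ⟨⟨⟨Dicke.Q_mem_NNExt, fun h =>
        (Dicke.exists_isHypergraphBosonicExtension hX h).elim fun _ hY => hY.mem_BExt⟩,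
      fun ⟨_, hY⟩ => Dicke.Q_mem_NNExt hY.mem_BExt,
      Dicke.exists_isHypergraphBosonicExtension hX⟩,
    ⟨Dicke.Q_mem_MomExt, fun h =>
        (Dicke.exists_isHypergraphPPTBosonicExtension hX h).elim fun _ hY => hY.mem_PPTBExt⟩,
      fun ⟨_, hY⟩ => Dicke.Q_mem_MomExt hY.mem_PPTBExt,
      Dicke.exists_isHypergraphPPTBosonicExtension hX⟩
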